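/- For a finite simple graph $G$ of order $n$ let $\lambda_1(G)\ge\cdots\ge\lambda_n(G)$ be the eigenvalues of its adjacency matrix, listed with multiplicity. For every integer $k\ge1$ put \[ c_k=\sup\left\{\frac{\lambda_k(G)}{n}: G\text{ is a graph of order } n\ge k\right\},\qquad c_{-k}=\sup\left\{\frac{|\lambda_{n-k+1}(G)|}{n}: G\text{ is a graph of order } n\ge k\right\}. \] If $q$ is an odd prime power and $k=q^2-q+1$, then \[ c_k>\frac{1}{2\sqrt{k-1}+1}\qquad\text{and}\qquad c_{-k+1}>\frac{1}{2\sqrt{k-1}+1}, \] where $c_{-k+1}=c_{-(k-1)}$. Moreover, the second bound remains true if, in the definition of $c_{-(k-1)}$, the quantity $|\lambda_{n-(k-1)+1}(G)|$ is replaced by $-\lambda_{n-(k-1)+1}(G)$; that is, \[ \sup\left\{\frac{-\lambda_{n-k+2}(G)}{n}: G\text{ is a graph of order } n\ge k-1\right\}>\frac{1}{2\sqrt{k-1}+1}. \] -/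

import Mathlib

noncomputable section

open Classical in
/-- The real adjacency matrix of a graph on `Fin n`. -/
def graphMatrix {n : ℕ} (G : SimpleGraph (Fin n)) : Matrix (Fin n) (Fin n) ℝ :=
  G.adjMatrix ℝ

theorem graphMatrix_isHermitian {n : ℕ} (G : SimpleGraph (Fin n)) :
    (graphMatrix G).IsHermitian := by
  classical
  ext i j
  simp [graphMatrix, SimpleGraph.adjMatrix_apply, SimpleGraph.adj_comm]

/-- `graphEigenvalue G i` is `λ_i(G)`, where `λ_1(G) ≥ ⋯ ≥ λ_n(G)` are the eigenvalues of the
adjacency matrix of `G`, with multiplicity (and `0` for an index outside `1, …, n`).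
Mathlib's `eigenvalues₀` lists them in nonincreasing order, starting at index `0`. -/
def graphEigenvalue {n : ℕ} (G : SimpleGraph (Fin n)) (i : ℕ) : ℝ :=
  if h : 1 ≤ i ∧ i ≤ n then
    (graphMatrix_isHermitian G).eigenvalues₀ ⟨i - 1, by rw [Fintype.card_fin]; omega⟩
  else 0

/-- `c_k = sup { λ_k(G) / n : G is a graph of order n ≥ k }`, for `k ≥ 1`. -/
def cPos (k : ℕ) : ℝ :=
  sSup {x : ℝ | ∃ (n : ℕ) (G : SimpleGraph (Fin n)), k ≤ n ∧ x = graphEigenvalue G k / n}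

/-- `c_{-k} = sup { |λ_{n-k+1}(G)| / n : G is a graph of order n ≥ k }`, for `k ≥ 1`. -/
def cNeg (k : ℕ) : ℝ :=
  sSup {x : ℝ | ∃ (n : ℕ) (G : SimpleGraph (Fin n)),
    k ≤ n ∧ x = |graphEigenvalue G (n - k + 1)| / n}

/-- The variant `sup { -λ_{n-k+1}(G) / n : G is a graph of order n ≥ k }` of `cNeg k`, for `k ≥ 1`,
to which positive values of `λ_{n-k+1}(G)` (possible for small `n`) do not contribute. -/
def cNegSigned (k : ℕ) : ℝ :=
  sSup {x : ℝ | ∃ (n : ℕ) (G : SimpleGraph (Fin n)),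
    k ≤ n ∧ x = -graphEigenvalue G (n - k + 1) / n}

end

/-! The extremal object is the unitary two-graph: a symmetric matrix `T` of order `q³ + 1`, zero on
the diagonal and `±1` elsewhere, with eigenvalues `q²` and `-q`. The trace gives `q²` multiplicity
`q² - q + 1 = k`. Write `J` for the all-ones matrix.

For the negative side, the graph with adjacency matrix `(J - I - T)/2` has Rayleigh quotient `-(q² +
1)/2` on the `q²`-eigenspace cut by the hyperplane orthogonal to the ones vector. The cut costs one
dimension, hence the index `k - 1`. For the positive side, `(J + I + T)/2` has quotient at least
`(q² + 1)/2` on the whole eigenspace because `J` is positive semidefinite. Its unit diagonal is paid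
for by blowing each vertex up into a clique of size `t`, which lowers the eigenvalue by only `1`.
Both ratios are essentially `(q² + 1)/(2(q³ + 1))`, which exceeds the claimed bound.

To build `T`, index it by the points of the Hermitian curve over the field of order `q²`, with
entries `χ(h(z, w))` for the Hermitian form `h` and quadratic character `χ`. The quadratic relation
for `T` follows from the symmetries of the curve (`sum_quadraticChar_hermForm_mul`) and one
character sum (`sum_traceCharSum_norm`, `traceCharSum_zero`). -/

/-! ### The quadratic character and the trace on the field of order `q²`. -/

section Conjugation

variable {K : Type*} [Field K] [Fintype K] {q : ℕ} {σ : K →+* K}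

theorem conj_conj (hK : Fintype.card K = q ^ 2) (hσ : ∀ x, σ x = x ^ q) (x : K) :
    σ (σ x) = x := by
  rw [hσ (σ x), hσ x, ← pow_mul, ← sq, ← hK, FiniteField.pow_card]

theorem ringChar_ne_two (hodd : Odd q) (hK : Fintype.card K = q ^ 2) : ringChar K ≠ 2 := by
  intro h
  have := FiniteField.even_card_iff_char_two.1 h
  rw [hK] at this
  exact Nat.not_even_iff_odd.2 hodd.pow (Nat.even_iff.2 this)

variable [DecidableEq K]

theorem card_roots_pow_add_mul_le (hq : 1 < q) (c t : K) :
    (Finset.univ.filter fun x : K => x ^ q + c * x = t).card ≤ q := by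
  open Polynomial in
  set p : K[X] := X ^ q + (C c * X - C t) with hp
  have hdeg : p.natDegree = q := by
    rw [hp, natDegree_add_eq_left_of_natDegree_lt, natDegree_X_pow]
    rw [natDegree_X_pow]
    refine lt_of_le_of_lt (b := 1) ?_ hq
    compute_degree
  have hne : p ≠ 0 := fun h => by rw [h, natDegree_zero] at hdeg; omega
  calc _ ≤ p.roots.toFinset.card := by
        apply Finset.card_le_card
        intro x hx
        simp only [Finset.mem_filter, Finset.mem_univ, true_and] at hx
        rw [Multiset.mem_toFinset, mem_roots hne, IsRoot.def, hp]
        simp [← hx]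
    _ ≤ p.roots.card := Multiset.toFinset_card_le _
    _ ≤ q := hdeg ▸ card_roots' p

/-- Traces lie in the fixed set of `σ`, which has at most `q` elements, and each fiber has at most
`q` (root counts). The fibers partition `q²` elements, so every bound is attained. -/
theorem card_trace_fiber (hq : 1 < q) (hK : Fintype.card K = q ^ 2) (hσ : ∀ x, σ x = x ^ q)
    {t : K} (ht : σ t = t) : (Finset.univ.filter fun x : K => x + σ x = t).card = q := by
  have hle (t : K) : (Finset.univ.filter fun x : K => x + σ x = t).card ≤ q := by
    convert! card_roots_pow_add_mul_le hq 1 t using 4 with x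
    rw [hσ, one_mul, add_comm]
  set F := Finset.univ.filter fun x : K => σ x = x with hF
  have hFq : F.card ≤ q := by
    convert! card_roots_pow_add_mul_le hq (-1 : K) 0 using 3 with x
    rw [hσ, neg_one_mul, ← sub_eq_add_neg, sub_eq_zero]
  have hsum : q ^ 2 = ∑ t ∈ F, (Finset.univ.filter fun x : K => x + σ x = t).card := by
    rw [← hK, ← Finset.card_univ]
    apply Finset.card_eq_sum_card_fiberwise
    intro x _
    simp [hF, conj_conj hK hσ, add_comm]
  have h1 : ∑ t ∈ F, (Finset.univ.filter fun x : K => x + σ x = t).card = ∑ t ∈ F, q := by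
    apply le_antisymm (Finset.sum_le_sum fun t _ => hle t)
    rw [← hsum, Finset.sum_const, smul_eq_mul, sq]
    exact Nat.mul_le_mul_right _ hFq
  exact (Finset.sum_eq_sum_iff_of_le fun t _ => hle t).1 h1 t (by simp [hF, ht])

/-- Nonzero elements of the subfield are squares: `t ^ (q - 1) = 1`, and `q - 1` divides `(q² - 1) /
2` since `q + 1` is even. -/
theorem quadraticChar_of_conj_eq_self (hodd : Odd q) (hK : Fintype.card K = q ^ 2)
    (hσ : ∀ x, σ x = x ^ q) {t : K} (ht : σ t = t) (h0 : t ≠ 0) : quadraticChar K t = 1 := by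
  rw [quadraticChar_eq_pow_of_char_ne_two (ringChar_ne_two hodd hK) h0, if_pos]
  obtain ⟨m, rfl⟩ := hodd
  have h1 : t ^ (2 * m) = 1 := by
    rw [hσ, pow_succ] at ht
    exact mul_right_cancel₀ h0 (by rw [ht, one_mul])
  have h2 : Fintype.card K / 2 = 2 * m * (m + 1) := by
    rw [hK, show (2 * m + 1) ^ 2 = 2 * (2 * m * (m + 1)) + 1 by ring]
    omega
  rw [h2, pow_mul, h1, one_pow]

theorem quadraticChar_mul_conj (hodd : Odd q) (hK : Fintype.card K = q ^ 2)
    (hσ : ∀ x, σ x = x ^ q) {t : K} (h0 : t ≠ 0) :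
    quadraticChar K t * quadraticChar K (σ t) = 1 := by
  rw [← map_mul]
  apply quadraticChar_of_conj_eq_self hodd hK hσ
  · rw [map_mul, conj_conj hK hσ, mul_comm]
  · exact mul_ne_zero h0 (by simpa using h0)

theorem quadraticChar_conj (hodd : Odd q) (hσ : ∀ x, σ x = x ^ q) (t : K) :
    quadraticChar K (σ t) = quadraticChar K t := by
  rw [hσ, map_pow]
  by_cases h0 : t = 0
  · simp [h0, hodd.pos.ne']
  · rcases quadraticChar_dichotomy h0 with h | h <;> simp [h, hodd.neg_one_pow]

theorem quadraticChar_inv' (t : K) : quadraticChar K t⁻¹ = quadraticChar K t := by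
  by_cases h0 : t = 0
  · simp [h0]
  · have h : quadraticChar K t⁻¹ * quadraticChar K t = 1 := by
      rw [← map_mul, inv_mul_cancel₀ h0, map_one]
    rcases quadraticChar_dichotomy h0 with h' | h' <;> rw [h'] at h ⊢ <;> omega

/-- The sum of the quadratic character over the elements of trace `t`. -/
def traceCharSum (σ : K →+* K) (t : K) : ℤ := ∑ x with x + σ x = t, quadraticChar K x

theorem traceCharSum_eq_one (hodd : Odd q) (hK : Fintype.card K = q ^ 2)
    (hσ : ∀ x, σ x = x ^ q) {t : K} (ht : σ t = t) (h0 : t ≠ 0) :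
    traceCharSum σ t = traceCharSum σ 1 := by
  unfold traceCharSum
  symm
  refine Finset.sum_bij' (fun x _ => t * x) (fun x _ => t⁻¹ * x) ?_ ?_ ?_ ?_ ?_
  · intro x hx
    simp only [Finset.mem_filter, Finset.mem_univ, true_and] at hx ⊢
    rw [map_mul, ht, ← mul_add, hx, mul_one]
  · intro x hx
    simp only [Finset.mem_filter, Finset.mem_univ, true_and] at hx ⊢
    rw [map_mul, map_inv₀, ht, ← mul_add, hx, inv_mul_cancel₀ h0]
  · intro x _
    simp [h0]
  · intro x _
    simp [h0]
  · intro x _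
    rw [map_mul, quadraticChar_of_conj_eq_self hodd hK hσ ht h0, one_mul]

/-- Let `S` be `traceCharSum`. It equals `S 1` at every nonzero fixed element, and `χ` sums to zero
over the field, so `S 0 + (q - 1) S 1 = 0`. The norm sum is `S 0 + (q² - 1) S 1 = S 0 - (q + 1) S
0`. -/
theorem sum_traceCharSum_norm (hq : 1 < q) (hodd : Odd q) (hK : Fintype.card K = q ^ 2)
    (hσ : ∀ x, σ x = x ^ q) :
    ∑ a : K, traceCharSum σ (a * σ a) = -q * traceCharSum σ 0 := by
  set F := Finset.univ.filter fun x : K => σ x = x with hF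
  have h0F : (0 : K) ∈ F := by simp [hF]
  have hFq : F.card = q := by
    have hsum : q ^ 2 = ∑ t ∈ F, (Finset.univ.filter fun x : K => x + σ x = t).card := by
      rw [← hK, ← Finset.card_univ]
      apply Finset.card_eq_sum_card_fiberwise
      intro x _
      simp [hF, conj_conj hK hσ, add_comm]
    rw [Finset.sum_congr rfl fun t ht => card_trace_fiber hq hK hσ (by simpa [hF] using ht),
      Finset.sum_const, smul_eq_mul, sq] at hsum
    exact (Nat.eq_of_mul_eq_mul_right (by omega) hsum).symm
  have htot : traceCharSum σ 0 + (q - 1) * traceCharSum σ (1 : K) = 0 := by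
    have h1 : ∑ t ∈ F, traceCharSum σ t = 0 := by
      rw [← quadraticChar_sum_zero (ringChar_ne_two (K := K) hodd hK)]
      apply Finset.sum_fiberwise_of_maps_to
      intro x _
      simp [hF, conj_conj hK hσ, add_comm]
    rw [← Finset.add_sum_erase _ _ h0F, Finset.sum_congr rfl fun t ht =>
      traceCharSum_eq_one hodd hK hσ (by simpa [hF] using Finset.mem_of_mem_erase ht)
        (Finset.ne_of_mem_erase ht), Finset.sum_const, Finset.card_erase_of_mem h0F, hFq,
      nsmul_eq_mul, Nat.cast_sub hq.le, Nat.cast_one] at h1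
    exact h1
  rw [← Finset.add_sum_erase _ _ (Finset.mem_univ (0 : K)), Finset.sum_congr rfl fun a ha =>
      traceCharSum_eq_one hodd hK hσ (t := a * σ a) (by rw [map_mul, conj_conj hK hσ, mul_comm])
        (mul_ne_zero (Finset.ne_of_mem_erase ha) (by simpa using Finset.ne_of_mem_erase ha)),
    Finset.sum_const, Finset.card_erase_of_mem (Finset.mem_univ _), Finset.card_univ, hK,
    nsmul_eq_mul, Nat.cast_sub (Nat.one_le_pow _ _ (by omega))]
  push_cast
  rw [zero_mul]
  linear_combination (q + 1 : ℤ) * htot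

/-- The quotient of two nonzero elements of trace zero is fixed by `σ`, hence a square, so `χ` is
constant on them. -/
theorem traceCharSum_zero (hq : 1 < q) (hodd : Odd q) (hK : Fintype.card K = q ^ 2)
    (hσ : ∀ x, σ x = x ^ q) :
    ∃ ε : ℤ, ε * ε = 1 ∧ traceCharSum σ (0 : K) = -ε * (q - 1) := by
  have hcard := card_trace_fiber hq hK hσ (map_zero σ)
  set F := Finset.univ.filter fun x : K => x + σ x = 0 with hF
  have h0F : (0 : K) ∈ F := by simp [hF]
  have hpos : 0 < (F.erase 0).card := by
    rw [Finset.card_erase_of_mem h0F, hcard]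
    omega
  obtain ⟨β, hβ⟩ := Finset.card_pos.1 hpos
  have hβ0 : β ≠ 0 := Finset.ne_of_mem_erase hβ
  have hβF : β + σ β = 0 := by simpa [hF] using Finset.mem_of_mem_erase hβ
  refine ⟨-quadraticChar K β, ?_, ?_⟩
  · rcases quadraticChar_dichotomy hβ0 with h | h <;> simp [h]
  · unfold traceCharSum
    rw [← hF, ← Finset.add_sum_erase _ _ h0F, Finset.sum_congr rfl (g := fun _ => quadraticChar K β),
      Finset.sum_const, Finset.card_erase_of_mem h0F, hcard, nsmul_eq_mul, Nat.cast_sub hq.le,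
      MulChar.map_zero]
    · push_cast
      ring
    · intro x hx
      have hx0 : x ≠ 0 := Finset.ne_of_mem_erase hx
      have hxF : x + σ x = 0 := by simpa [hF] using Finset.mem_of_mem_erase hx
      have h : quadraticChar K (x * β⁻¹) = 1 := by
        apply quadraticChar_of_conj_eq_self hodd hK hσ _ (mul_ne_zero hx0 (inv_ne_zero hβ0))
        rw [map_mul, map_inv₀, ← neg_eq_of_add_eq_zero_right hxF,
          ← neg_eq_of_add_eq_zero_right hβF, inv_neg, neg_mul_neg]
      rw [← mul_one (quadraticChar K β), ← h, ← map_mul]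
      congr 1
      field_simp

end Conjugation

/-! ### The Hermitian curve, its symmetries and its character matrix. -/

section Unital

variable {K : Type*} [Field K] {q : ℕ} {σ : K →+* K}

/-- The affine points of the Hermitian curve `b + b^σ = a * a^σ`. -/
abbrev UnitalPoint (σ : K →+* K) : Type _ := {z : K × K // z.2 + σ z.2 = z.1 * σ z.1}

/-- The Hermitian form evaluated at two affine points `(1, a, b)` of the curve. -/
def hermForm (σ : K →+* K) (z w : K × K) : K := z.2 + σ w.2 - z.1 * σ w.1

theorem hermForm_conj (hσσ : ∀ x, σ (σ x) = x) (z w : K × K) :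
    σ (hermForm σ z w) = hermForm σ w z := by
  simp only [hermForm, map_add, map_sub, map_mul, hσσ]
  ring

/-- Translation by the point `y` in the Heisenberg group acting on the Hermitian curve. -/
def unitalTranslate (hσσ : ∀ x, σ (σ x) = x) (y : UnitalPoint σ) :
    UnitalPoint σ ≃ UnitalPoint σ where
  toFun z := ⟨(z.1.1 + y.1.1, z.1.2 + y.1.2 + z.1.1 * σ y.1.1), by
    have hz := z.2
    have hy := y.2
    simp only [map_add, map_mul, hσσ]
    linear_combination hz + hy⟩
  invFun z := ⟨(z.1.1 - y.1.1, z.1.2 - y.1.2 - (z.1.1 - y.1.1) * σ y.1.1), by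
    have hz := z.2
    have hy := y.2
    simp only [map_sub, map_mul, hσσ]
    linear_combination hz - hy⟩
  left_inv z := by
    ext
    · simp
    · simp only [add_sub_cancel_right]
      ring
  right_inv z := by
    ext
    · simp
    · ring

theorem hermForm_unitalTranslate (hσσ : ∀ x, σ (σ x) = x) (y z w : UnitalPoint σ) :
    hermForm σ (unitalTranslate hσσ y z).1 (unitalTranslate hσσ y w).1 = hermForm σ z.1 w.1 := by
  have hy := y.2
  simp only [hermForm, unitalTranslate, Equiv.coe_fn_mk, map_add, map_mul, hσσ]
  linear_combination hy

/-- The origin of the Hermitian curve. -/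
def unitalZero (σ : K →+* K) : UnitalPoint σ := ⟨(0, 0), by simp⟩

theorem unitalTranslate_zero (hσσ : ∀ x, σ (σ x) = x) (y : UnitalPoint σ) :
    unitalTranslate hσσ y (unitalZero σ) = y := by
  ext <;> simp [unitalTranslate, unitalZero]

theorem hermForm_zero_left (w : K × K) : hermForm σ (unitalZero σ).1 w = σ w.2 := by
  simp [hermForm, unitalZero]

theorem hermForm_zero_right (w : K × K) : hermForm σ w (unitalZero σ).1 = w.2 := by
  simp [hermForm, unitalZero]

theorem hermForm_unitalTranslate_left (hσσ : ∀ x, σ (σ x) = x) (w z : UnitalPoint σ) :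
    hermForm σ (unitalTranslate hσσ w z).1 w.1 = z.1.2 := by
  have h := hermForm_unitalTranslate hσσ w z (unitalZero σ)
  rwa [unitalTranslate_zero, hermForm_zero_right] at h

theorem hermForm_unitalTranslate_right (hσσ : ∀ x, σ (σ x) = x) (w z : UnitalPoint σ) :
    hermForm σ w.1 (unitalTranslate hσσ w z).1 = σ z.1.2 := by
  rw [← hermForm_conj hσσ, hermForm_unitalTranslate_left]

theorem unitalPoint_snd_eq_zero {z : UnitalPoint σ} : z.1.2 = 0 ↔ z = unitalZero σ := by
  constructor
  · intro h
    have hz := z.2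
    rw [h, map_zero, add_zero, eq_comm, mul_eq_zero, map_eq_zero, or_self] at hz
    exact Subtype.ext (Prod.ext hz h)
  · rintro rfl
    rfl

theorem hermForm_eq_zero (hσσ : ∀ x, σ (σ x) = x) {z w : UnitalPoint σ} :
    hermForm σ z.1 w.1 = 0 ↔ z = w := by
  obtain ⟨v, rfl⟩ := (unitalTranslate hσσ w).surjective z
  rw [hermForm_unitalTranslate_left, unitalPoint_snd_eq_zero]
  constructor
  · rintro rfl
    exact unitalTranslate_zero hσσ w
  · intro h
    exact (unitalTranslate hσσ w).injective (h.trans (unitalTranslate_zero hσσ w).symm)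

/-- The map `(a, b) ↦ (a / b, 1 / b)` on the Hermitian curve, fixing the origin. -/
def unitalInvert (z : UnitalPoint σ) : UnitalPoint σ :=
  ⟨(z.1.1 * z.1.2⁻¹, z.1.2⁻¹), by
    by_cases h : z.1.2 = 0
    · simp [h]
    · have h' : σ z.1.2 ≠ 0 := by simpa using h
      have hz := z.2
      simp only [map_inv₀, map_mul]
      field_simp
      linear_combination hz⟩

theorem unitalInvert_involutive : Function.Involutive (unitalInvert (σ := σ)) := by
  intro z
  by_cases h : z.1.2 = 0
  · rw [unitalPoint_snd_eq_zero] at h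
    subst h
    ext <;> simp [unitalZero, unitalInvert]
  · ext <;> simp [unitalInvert, h]

theorem unitalInvert_zero : unitalInvert (unitalZero σ) = unitalZero σ := by
  ext <;> simp [unitalInvert, unitalZero]

theorem hermForm_unitalInvert {z w : UnitalPoint σ} (hz : z.1.2 ≠ 0) (hw : w.1.2 ≠ 0) :
    hermForm σ z.1 w.1 =
      z.1.2 * σ w.1.2 * hermForm σ (unitalInvert z).1 (unitalInvert w).1 := by
  have h' : σ w.1.2 ≠ 0 := by simpa using hw
  simp only [hermForm, unitalInvert, map_mul, map_inv₀]
  field_simp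
  ring

variable [Fintype K] [DecidableEq K]

theorem card_unitalPoint (hq : 1 < q) (hK : Fintype.card K = q ^ 2) (hσ : ∀ x, σ x = x ^ q) :
    Fintype.card (UnitalPoint σ) = q ^ 3 := by
  rw [Fintype.card_subtype, Finset.card_filter, Fintype.sum_prod_type]
  simp only [← Finset.card_filter]
  rw [Finset.sum_congr rfl fun a _ => card_trace_fiber hq hK hσ (t := a * σ a)
    (by rw [map_mul, conj_conj hK hσ, mul_comm]), Finset.sum_const, Finset.card_univ, hK,
    smul_eq_mul]
  ring

theorem sum_quadraticChar_snd (hq : 1 < q) (hodd : Odd q) (hK : Fintype.card K = q ^ 2)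
    (hσ : ∀ x, σ x = x ^ q) :
    ∑ z : UnitalPoint σ, quadraticChar K z.1.2 = -q * traceCharSum σ (0 : K) := by
  rw [← sum_traceCharSum_norm hq hodd hK hσ]
  rw [← Finset.sum_subtype (Finset.univ.filter fun z : K × K => z.2 + σ z.2 = z.1 * σ z.1)
    (by simp) fun z : K × K => quadraticChar K z.2, Finset.sum_filter, Fintype.sum_prod_type]
  simp only [traceCharSum, Finset.sum_filter]

theorem sum_quadraticChar_hermForm (hσσ : ∀ x, σ (σ x) = x) (w : UnitalPoint σ) :
    ∑ z : UnitalPoint σ, quadraticChar K (hermForm σ z.1 w.1) =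
      ∑ z : UnitalPoint σ, quadraticChar K z.1.2 := by
  rw [← (unitalTranslate hσσ w).sum_comp]
  simp only [hermForm_unitalTranslate_left]

theorem sum_quadraticChar_hermForm_mul_self (hodd : Odd q) (hK : Fintype.card K = q ^ 2)
    (hσ : ∀ x, σ x = x ^ q) (x : UnitalPoint σ) :
    ∑ z : UnitalPoint σ,
      quadraticChar K (hermForm σ x.1 z.1) * quadraticChar K (hermForm σ z.1 x.1) =
      Fintype.card (UnitalPoint σ) - 1 := by
  have hσσ := conj_conj hK hσ
  rw [← Finset.add_sum_erase _ _ (Finset.mem_univ x), (hermForm_eq_zero hσσ).2 rfl,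
    MulChar.map_zero, zero_mul, zero_add, Finset.sum_congr rfl (g := fun _ => (1 : ℤ)),
    Finset.sum_const, Finset.card_erase_of_mem (Finset.mem_univ x), Finset.card_univ,
    nsmul_eq_mul, mul_one, Nat.cast_sub (Fintype.card_pos_iff.2 ⟨x⟩), Nat.cast_one]
  intro z hz
  rw [← hermForm_conj hσσ x.1 z.1]
  exact quadraticChar_mul_conj hodd hK hσ
    fun h => Finset.ne_of_mem_erase hz ((hermForm_eq_zero hσσ).1 h).symm

theorem sum_quadraticChar_snd_mul_hermForm (hσσ : ∀ x, σ (σ x) = x)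
    (hχ : ∀ t, quadraticChar K (σ t) = quadraticChar K t) {w : UnitalPoint σ}
    (hw : w ≠ unitalZero σ) :
    ∑ z : UnitalPoint σ, quadraticChar K z.1.2 * quadraticChar K (hermForm σ z.1 w.1) =
      (∑ z : UnitalPoint σ, quadraticChar K z.1.2) * quadraticChar K w.1.2 - 1 := by
  have hw' : w.1.2 ≠ 0 := fun h => hw (unitalPoint_snd_eq_zero.1 h)
  -- Inversion rescales the form by `b_z σ(b_w)`, and `χ(b_z)² = 1` away from the origin. At the
  -- origin the left side is `0` while the product on the right is `χ(b_w)² = 1`, hence the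
  -- correction.
  have key (z : UnitalPoint σ) :
      quadraticChar K z.1.2 * quadraticChar K (hermForm σ z.1 w.1) =
      quadraticChar K w.1.2 *
        quadraticChar K (hermForm σ (unitalInvert z).1 (unitalInvert w).1) -
      if z = unitalZero σ then 1 else 0 := by
    by_cases hz : z.1.2 = 0
    · rw [unitalPoint_snd_eq_zero] at hz
      subst hz
      simp only [if_pos, unitalInvert_zero, hermForm_zero_left, hχ]
      have h : quadraticChar K (unitalInvert w).1.2 = quadraticChar K w.1.2 :=
        quadraticChar_inv' _
      rw [h, ← sq (quadraticChar K w.1.2), quadraticChar_sq_one hw', sub_self]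
      simp [unitalZero]
    · rw [if_neg fun h => hz (unitalPoint_snd_eq_zero.2 h), hermForm_unitalInvert hz hw',
        map_mul, map_mul, hχ]
      linear_combination quadraticChar K w.1.2 *
        quadraticChar K (hermForm σ (unitalInvert z).1 (unitalInvert w).1) *
        quadraticChar_sq_one hz
  rw [Finset.sum_congr rfl fun z _ => key z, Finset.sum_sub_distrib, ← Finset.mul_sum,
    (Function.Involutive.bijective unitalInvert_involutive).sum_comp
      fun z => quadraticChar K (hermForm σ z.1 (unitalInvert w).1),
    sum_quadraticChar_hermForm hσσ]
  simp [mul_comm]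

/-- Translation moves `x` to the origin, where inversion evaluates the sum. The `-1` is what the
point at infinity (`none`) cancels in the square of `unitalMatrix`. -/
theorem sum_quadraticChar_hermForm_mul (hσσ : ∀ x, σ (σ x) = x)
    (hχ : ∀ t, quadraticChar K (σ t) = quadraticChar K t) {x y : UnitalPoint σ} (hxy : x ≠ y) :
    ∑ z : UnitalPoint σ,
      quadraticChar K (hermForm σ x.1 z.1) * quadraticChar K (hermForm σ z.1 y.1) =
      (∑ z : UnitalPoint σ, quadraticChar K z.1.2) * quadraticChar K (hermForm σ x.1 y.1) - 1 := by
  obtain ⟨w, rfl⟩ := (unitalTranslate hσσ x).surjective y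
  have hw : w ≠ unitalZero σ := by
    rintro rfl
    exact hxy (unitalTranslate_zero hσσ x).symm
  rw [← (unitalTranslate hσσ x).sum_comp]
  simp only [hermForm_unitalTranslate_right, hχ, hermForm_unitalTranslate]
  exact sum_quadraticChar_snd_mul_hermForm hσσ hχ hw

/-- The Seidel matrix of the unitary two-graph, up to sign. -/
def unitalMatrix (σ : K →+* K) : Matrix (Option (UnitalPoint σ)) (Option (UnitalPoint σ)) ℤ
  | none, none => 0
  | none, some _ => 1
  | some _, none => 1
  | some z, some w => quadraticChar K (hermForm σ z.1 w.1)

theorem unitalMatrix_mul_self (hq : 1 < q) (hodd : Odd q) (hK : Fintype.card K = q ^ 2)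
    (hσ : ∀ x, σ x = x ^ q) {r : ℤ} (hr : ∑ z : UnitalPoint σ, quadraticChar K z.1.2 = r) :
    unitalMatrix σ * unitalMatrix σ = r • unitalMatrix σ + (q : ℤ) ^ 3 • 1 := by
  have hσσ := conj_conj hK hσ
  have hχ := quadraticChar_conj (K := K) hodd hσ
  have hc : (Fintype.card (UnitalPoint σ) : ℤ) = q ^ 3 := by
    rw [card_unitalPoint hq hK hσ]
    push_cast
    rfl
  ext (_ | x) (_ | y)
  · simp [-zsmul_eq_mul, -zsmul_one, -quadraticChar_apply, Matrix.mul_apply,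
      Fintype.sum_option, unitalMatrix, hc]
  · simp [-zsmul_eq_mul, -zsmul_one, -quadraticChar_apply, Matrix.mul_apply,
      Fintype.sum_option, unitalMatrix, sum_quadraticChar_hermForm hσσ, hr]
  · have h (z : UnitalPoint σ) : quadraticChar K (hermForm σ x.1 z.1) =
        quadraticChar K (hermForm σ z.1 x.1) := by rw [← hermForm_conj hσσ, hχ]
    simp [-zsmul_eq_mul, -zsmul_one, -quadraticChar_apply, Matrix.mul_apply,
      Fintype.sum_option, unitalMatrix, h,
      sum_quadraticChar_hermForm hσσ, hr]
  · by_cases hxy : x = y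
    · subst hxy
      simp [-zsmul_eq_mul, -zsmul_one, -quadraticChar_apply, Matrix.mul_apply,
        Fintype.sum_option, unitalMatrix,
        sum_quadraticChar_hermForm_mul_self hodd hK hσ, (hermForm_eq_zero hσσ).2, hc, quadraticChar_zero]
    · simp [-zsmul_eq_mul, -zsmul_one, -quadraticChar_apply, Matrix.mul_apply,
        Fintype.sum_option, unitalMatrix,
        sum_quadraticChar_hermForm_mul hσσ hχ hxy, hr, hxy]

end Unital

/-! ### Existence of the two-graph for every odd prime power. -/

theorem exists_field_conj {q : ℕ} (hq : IsPrimePow q) :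
    ∃ (K : Type) (_ : Field K) (_ : Fintype K) (σ : K →+* K),
      Fintype.card K = q ^ 2 ∧ ∀ x, σ x = x ^ q := by
  obtain ⟨p, m, hp, hm, rfl⟩ := hq
  have : Fact p.Prime := ⟨hp.nat_prime⟩
  have : Fintype (GaloisField p (m * 2)) := Fintype.ofFinite _
  refine ⟨GaloisField p (m * 2), inferInstance, inferInstance, iterateFrobenius _ p m, ?_, ?_⟩
  · rw [← Nat.card_eq_fintype_card, GaloisField.card p _ (by omega), pow_mul]
  · intro x
    rw [iterateFrobenius_def]

/-- A regular two-graph with the parameters of the unitary two-graph exists. -/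
theorem exists_unitary_seidelMatrix {q : ℕ} (hq : IsPrimePow q) (hodd : Odd q) :
    ∃ (V : Type) (_ : Fintype V) (_ : DecidableEq V) (T : Matrix V V ℤ),
      Fintype.card V = q ^ 3 + 1 ∧ T.IsSymm ∧ (∀ i, T i i = 0) ∧
      (∀ i j, i ≠ j → T i j = 1 ∨ T i j = -1) ∧
      T * T = ((q : ℤ) ^ 2 - q) • T + (q : ℤ) ^ 3 • 1 := by
  classical
  have hq1 := hq.one_lt
  obtain ⟨K, _, _, σ, hK, hσ⟩ := exists_field_conj hq
  obtain ⟨ε, hε, hsum⟩ := traceCharSum_zero (K := K) hq1 hodd hK hσ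
  have hσσ := conj_conj hK hσ
  have hχ := quadraticChar_conj (K := K) hodd hσ
  have hr : ∑ z : UnitalPoint σ, quadraticChar K z.1.2 = ε * ((q : ℤ) ^ 2 - q) := by
    rw [sum_quadraticChar_snd hq1 hodd hK hσ, hsum]
    ring
  -- The character sum is only known up to the sign `ε`; multiplying the matrix by `ε` makes the
  -- linear coefficient `q² - q`.
  refine ⟨Option (UnitalPoint σ), inferInstance, inferInstance, ε • unitalMatrix σ,
    ?_, ?_, ?_, ?_, ?_⟩
  · rw [Fintype.card_option, card_unitalPoint hq1 hK hσ]
  · ext (_ | x) (_ | y) <;> simp [-zsmul_eq_mul, -zsmul_one, -quadraticChar_apply, unitalMatrix]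
    rw [← hermForm_conj hσσ, hχ]
    simp
  · rintro (_ | x) <;> simp [-quadraticChar_apply, unitalMatrix,
      (hermForm_eq_zero hσσ).2, quadraticChar_zero]
  · have hε' := mul_self_eq_one_iff.1 hε
    rintro (_ | x) (_ | y) hxy
    · exact (hxy rfl).elim
    · simpa [unitalMatrix] using hε'
    · simpa [unitalMatrix] using hε'
    · have h := quadraticChar_dichotomy (F := K)
        fun h => hxy (congrArg some ((hermForm_eq_zero hσσ (z := x) (w := y)).1 h))
      rcases hε' with rfl | rfl <;> rcases h with h | h <;>
        simp [-quadraticChar_apply, unitalMatrix, h]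
  · rw [Matrix.smul_mul, Matrix.mul_smul, smul_smul, hε, one_smul,
      unitalMatrix_mul_self hq1 hodd hK hσ hr, smul_smul, mul_comm ε]

/-! ### Courant–Fischer bounds for graph eigenvalues. -/

section Spectral

open Matrix Module

variable {n : ℕ} {A : Matrix (Fin n) (Fin n) ℝ}

theorem Matrix.IsHermitian.dotProduct_mulVec_eq_sum (hA : A.IsHermitian) (x : Fin n → ℝ) :
    x ⬝ᵥ A *ᵥ x = ∑ i, hA.eigenvalues i * (⇑(hA.eigenvectorBasis i) ⬝ᵥ x) ^ 2 := by
  have h := hA.eigenvectorBasis.sum_inner_mul_inner (WithLp.toLp 2 x) (WithLp.toLp 2 (A *ᵥ x))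
  rw [EuclideanSpace.inner_toLp_toLp, star_trivial, dotProduct_comm] at h
  rw [← h]
  refine Finset.sum_congr rfl fun i _ => ?_
  have h1 : inner ℝ (WithLp.toLp 2 x) (hA.eigenvectorBasis i) = hA.eigenvectorBasis i ⬝ᵥ x := rfl
  have h2 : inner ℝ (hA.eigenvectorBasis i) (WithLp.toLp 2 (A *ᵥ x)) =
      (A *ᵥ x) ⬝ᵥ hA.eigenvectorBasis i := rfl
  have hT : Aᵀ = A := hA
  rw [h1, h2, dotProduct_comm (A *ᵥ x), dotProduct_mulVec, ← mulVec_transpose, hT,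
    hA.mulVec_eigenvectorBasis, smul_dotProduct, smul_eq_mul]
  ring

theorem Matrix.IsHermitian.dotProduct_self_eq_sum (hA : A.IsHermitian) (x : Fin n → ℝ) :
    x ⬝ᵥ x = ∑ i, (⇑(hA.eigenvectorBasis i) ⬝ᵥ x) ^ 2 := by
  have h := hA.eigenvectorBasis.sum_inner_mul_inner (WithLp.toLp 2 x) (WithLp.toLp 2 x)
  rw [EuclideanSpace.inner_toLp_toLp, star_trivial] at h
  rw [← h]
  refine Finset.sum_congr rfl fun i _ => ?_
  have h1 : inner ℝ (WithLp.toLp 2 x) (hA.eigenvectorBasis i) = hA.eigenvectorBasis i ⬝ᵥ x := rfl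
  rw [real_inner_comm (WithLp.toLp 2 x), h1, sq]

/-- Orthogonality to the eigenvectors outside `I` imposes `n - |I|` linear conditions, fewer than
the dimension of `W`. -/
theorem Matrix.IsHermitian.exists_mem_dotProduct_eq_zero (hA : A.IsHermitian)
    (W : Submodule ℝ (Fin n → ℝ)) (I : Finset (Fin n)) (h : n < I.card + finrank ℝ W) :
    ∃ x ∈ W, x ≠ 0 ∧ ∀ i ∉ I, ⇑(hA.eigenvectorBasis i) ⬝ᵥ x = 0 := by
  let f : W →ₗ[ℝ] ({i // i ∉ I} → ℝ) :=
    (LinearMap.pi fun i => dotProductBilin ℝ ℝ ⇑(hA.eigenvectorBasis i.1)) ∘ₗ W.subtype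
  have hf : LinearMap.ker f ≠ ⊥ := by
    apply LinearMap.ker_ne_bot_of_finrank_lt
    have hI := I.card_le_univ
    rw [Fintype.card_fin] at hI
    rw [finrank_fintype_fun_eq_card, Fintype.card_subtype_compl, Fintype.card_fin,
      Fintype.card_coe]
    omega
  obtain ⟨x, hx, hx0⟩ := Submodule.exists_mem_ne_zero_of_ne_bot hf
  refine ⟨x, x.2, by simpa using hx0, fun i hi => ?_⟩
  exact congrFun (LinearMap.mem_ker.1 hx) ⟨i, hi⟩

theorem graphEigenvalue_eq (G : SimpleGraph (Fin n)) {i : ℕ} (h : 1 ≤ i ∧ i ≤ n)  :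
    graphEigenvalue G i = (graphMatrix_isHermitian G).eigenvalues₀
      ⟨i - 1, by rw [Fintype.card_fin]; omega⟩ := by
  rw [graphEigenvalue, dif_pos h]

/-- A subspace of dimension `d` on which the Rayleigh quotient is at least `c` forces
`λ_d(G) ≥ c`. -/
theorem le_graphEigenvalue (G : SimpleGraph (Fin n)) (W : Submodule ℝ (Fin n → ℝ)) {d : ℕ} {c : ℝ}
    (hd : 1 ≤ d) (hW : d ≤ finrank ℝ W)
    (h : ∀ x ∈ W, c * (x ⬝ᵥ x) ≤ x ⬝ᵥ graphMatrix G *ᵥ x) : c ≤ graphEigenvalue G d := by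
  have hdn : d ≤ n := hW.trans (by simpa using W.finrank_le)
  have hA := graphMatrix_isHermitian G
  rw [graphEigenvalue_eq G ⟨hd, hdn⟩]
  set j : Fin (Fintype.card (Fin n)) := ⟨d - 1, by rw [Fintype.card_fin]; omega⟩ with hj
  let e : Fin (Fintype.card (Fin n)) ≃ Fin n := Fintype.equivOfCardEq (Fintype.card_fin _)
  -- The `n - d + 1` indices from `d - 1` on carry the eigenvalues at most `λ_d`; their eigenvectors
  -- span a space that must meet `W`.
  obtain ⟨x, hxW, hx0, hx⟩ := hA.exists_mem_dotProduct_eq_zero W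
    ((Finset.Ici j).map e.toEmbedding) (by
      simp only [Finset.card_map, Fin.card_Ici, hj, Fintype.card_fin]
      omega)
  have hpos : 0 < x ⬝ᵥ x :=
    lt_of_le_of_ne (by simpa using dotProduct_star_self_nonneg x)
      fun h0 => hx0 (dotProduct_self_eq_zero.1 h0.symm)
  refine le_of_mul_le_mul_right ((h x hxW).trans ?_) hpos
  rw [hA.dotProduct_mulVec_eq_sum, hA.dotProduct_self_eq_sum, Finset.mul_sum]
  refine Finset.sum_le_sum fun i _ => ?_
  by_cases hi : i ∈ (Finset.Ici j).map e.toEmbedding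
  · refine mul_le_mul_of_nonneg_right ?_ (sq_nonneg _)
    obtain ⟨l, hl, rfl⟩ := Finset.mem_map.1 hi
    apply hA.eigenvalues₀_antitone
    simpa [e] using hl
  · simp [hx i hi]

/-- A subspace of dimension `d` on which the Rayleigh quotient is at most `c` forces
`λ_{n-d+1}(G) ≤ c`. -/
theorem graphEigenvalue_le (G : SimpleGraph (Fin n)) (W : Submodule ℝ (Fin n → ℝ)) {d : ℕ} {c : ℝ}
    (hd : 1 ≤ d) (hW : d ≤ finrank ℝ W)
    (h : ∀ x ∈ W, x ⬝ᵥ graphMatrix G *ᵥ x ≤ c * (x ⬝ᵥ x)) : graphEigenvalue G (n - d + 1) ≤ c := by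
  have hdn : d ≤ n := hW.trans (by simpa using W.finrank_le)
  have hA := graphMatrix_isHermitian G
  rw [graphEigenvalue_eq G ⟨by omega, by omega⟩]
  set j : Fin (Fintype.card (Fin n)) := ⟨n - d + 1 - 1, by rw [Fintype.card_fin]; omega⟩ with hj
  let e : Fin (Fintype.card (Fin n)) ≃ Fin n := Fintype.equivOfCardEq (Fintype.card_fin _)
  obtain ⟨x, hxW, hx0, hx⟩ := hA.exists_mem_dotProduct_eq_zero W
    ((Finset.Iic j).map e.toEmbedding) (by
      rw [Finset.card_map, Fin.card_Iic]
      simp only [hj]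
      omega)
  have hpos : 0 < x ⬝ᵥ x :=
    lt_of_le_of_ne (by simpa using dotProduct_star_self_nonneg x)
      fun h0 => hx0 (dotProduct_self_eq_zero.1 h0.symm)
  refine le_of_mul_le_mul_right (le_trans ?_ (h x hxW)) hpos
  rw [hA.dotProduct_mulVec_eq_sum, hA.dotProduct_self_eq_sum, Finset.mul_sum]
  refine Finset.sum_le_sum fun i _ => ?_
  by_cases hi : i ∈ (Finset.Iic j).map e.toEmbedding
  · refine mul_le_mul_of_nonneg_right ?_ (sq_nonneg _)
    obtain ⟨l, hl, rfl⟩ := Finset.mem_map.1 hi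
    apply hA.eigenvalues₀_antitone
    simpa [e] using hl
  · simp [hx i hi]

/-- Gershgorin's theorem. This bounds the sets defining the suprema, without which `sSup` would take
its default value. -/
theorem abs_graphEigenvalue_le (G : SimpleGraph (Fin n)) (i : ℕ) : |graphEigenvalue G i| ≤ n := by
  classical
  by_cases hi : 1 ≤ i ∧ i ≤ n
  · have hA := graphMatrix_isHermitian G
    let e : Fin (Fintype.card (Fin n)) ≃ Fin n := Fintype.equivOfCardEq (Fintype.card_fin _)
    have h : graphEigenvalue G i =
        hA.eigenvalues (e ⟨i - 1, by rw [Fintype.card_fin]; omega⟩) := by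
      rw [graphEigenvalue_eq G hi, Matrix.IsHermitian.eigenvalues, Equiv.symm_apply_apply]
    have hev : Module.End.HasEigenvalue (Matrix.toLin' (graphMatrix G)) (graphEigenvalue G i) := by
      rw [Module.End.hasEigenvalue_iff_mem_spectrum, Matrix.spectrum_toLin', h]
      exact hA.eigenvalues_mem_spectrum_real _
    obtain ⟨k, hk⟩ := eigenvalue_mem_ball hev
    have hle (a b : Fin n) : ‖graphMatrix G a b‖ ≤ 1 := by
      rw [graphMatrix, SimpleGraph.adjMatrix_apply]
      split_ifs <;> simp
    have hkk : graphMatrix G k k = 0 := by simp [graphMatrix]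
    rw [hkk, mem_closedBall_zero_iff, Real.norm_eq_abs] at hk
    calc _ ≤ _ := hk
      _ ≤ ∑ j ∈ Finset.univ.erase k, (1 : ℝ) := Finset.sum_le_sum fun j _ => hle k j
      _ ≤ ∑ j : Fin n, (1 : ℝ) :=
        Finset.sum_le_sum_of_subset_of_nonneg (Finset.erase_subset _ _) (by simp)
      _ = n := by simp
  · rw [graphEigenvalue, dif_neg hi]
    simp

theorem abs_graphEigenvalue_div_le (G : SimpleGraph (Fin n)) (i : ℕ) :
    |graphEigenvalue G i| / n ≤ 1 :=
  div_le_one_of_le₀ (abs_graphEigenvalue_le G i) (Nat.cast_nonneg n)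

theorem graphEigenvalue_div_le_cPos (G : SimpleGraph (Fin n)) {k : ℕ} (hk : k ≤ n) :
    graphEigenvalue G k / n ≤ cPos k := by
  refine le_csSup ⟨1, ?_⟩ ⟨n, G, hk, rfl⟩
  rintro _ ⟨m, H, -, rfl⟩
  exact le_trans (div_le_div_of_nonneg_right (le_abs_self _) (Nat.cast_nonneg m))
    (abs_graphEigenvalue_div_le H k)

theorem abs_graphEigenvalue_div_le_cNeg (G : SimpleGraph (Fin n)) {k : ℕ} (hk : k ≤ n) :
    |graphEigenvalue G (n - k + 1)| / n ≤ cNeg k := by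
  refine le_csSup ⟨1, ?_⟩ ⟨n, G, hk, rfl⟩
  rintro _ ⟨m, H, -, rfl⟩
  exact abs_graphEigenvalue_div_le H _

theorem neg_graphEigenvalue_div_le_cNegSigned (G : SimpleGraph (Fin n)) {k : ℕ} (hk : k ≤ n) :
    -graphEigenvalue G (n - k + 1) / n ≤ cNegSigned k := by
  refine le_csSup ⟨1, ?_⟩ ⟨n, G, hk, rfl⟩
  rintro _ ⟨m, H, -, rfl⟩
  exact le_trans (div_le_div_of_nonneg_right (neg_le_abs _) (Nat.cast_nonneg m))
    (abs_graphEigenvalue_div_le H _)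

end Spectral

/-! ### From the Seidel matrix to graphs with large eigenvalues. -/

section Seidel

open Matrix Module

theorem exists_unitary_seidelMatrix_fin {q : ℕ} (hq : IsPrimePow q) (hodd : Odd q) :
    ∃ T : Matrix (Fin (q ^ 3 + 1)) (Fin (q ^ 3 + 1)) ℝ,
      (∀ i, T i i = 0) ∧ (∀ i j, T i j = T j i) ∧
      (∀ i j, i ≠ j → T i j = 1 ∨ T i j = -1) ∧
      T * T = ((q : ℝ) ^ 2 - q) • T + (q : ℝ) ^ 3 • 1 := by
  obtain ⟨V, _, _, T, hV, hs, h0, h1, hT⟩ := exists_unitary_seidelMatrix hq hodd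
  let e : Fin (q ^ 3 + 1) ≃ V := (Fintype.equivFinOfCardEq hV).symm
  refine ⟨Matrix.of fun i j => (T (e i) (e j) : ℝ), fun i => by simp [h0], fun i j => ?_,
    fun i j hij => ?_, ?_⟩
  · rw [of_apply, of_apply, hs.apply]
  · rw [of_apply]
    exact_mod_cast h1 _ _ (e.injective.ne hij)
  · ext i j
    have h := congrFun (congrFun hT (e i)) (e j)
    rw [Matrix.mul_apply, ← e.sum_comp] at h
    have h' := congrArg (Int.cast : ℤ → ℝ) h
    rw [Matrix.mul_apply]
    simp only [Matrix.add_apply, Matrix.smul_apply, smul_eq_mul, Matrix.one_apply,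
      e.apply_eq_iff_eq, of_apply] at h' ⊢
    push_cast at h'
    exact h'

/-- The eigenspace for the larger eigenvalue of a Seidel matrix with two eigenvalues `q²`, `-q`. -/
theorem exists_eigenspace_of_mul_self {q : ℕ} (hq : 0 < q)
    {T : Matrix (Fin (q ^ 3 + 1)) (Fin (q ^ 3 + 1)) ℝ} (h0 : ∀ i, T i i = 0)
    (hT : T * T = ((q : ℝ) ^ 2 - q) • T + (q : ℝ) ^ 3 • 1) :
    ∃ W : Submodule ℝ (Fin (q ^ 3 + 1) → ℝ), finrank ℝ W = q ^ 2 - q + 1 ∧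
      ∀ x ∈ W, T *ᵥ x = (q : ℝ) ^ 2 • x := by
  have hq' : (0 : ℝ) < (q : ℝ) ^ 2 + q := by positivity
  -- The spectral projection onto the `q²`-eigenspace. Its rank is its trace, `q(q³ + 1)/(q² + q)`,
  -- because `T` has zero diagonal.
  set P : Matrix (Fin (q ^ 3 + 1)) (Fin (q ^ 3 + 1)) ℝ :=
    ((q : ℝ) ^ 2 + q)⁻¹ • (T + (q : ℝ) • 1) with hP
  have hTP : T * P = (q : ℝ) ^ 2 • P := by
    rw [hP, Matrix.mul_smul, mul_add, hT, Matrix.mul_smul, mul_one]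
    module
  have hPP : P * P = P := by
    conv_lhs => lhs; rw [hP]
    rw [Matrix.smul_mul, add_mul, hTP, Matrix.smul_mul, one_mul, ← add_smul, smul_smul,
      inv_mul_cancel₀ hq'.ne', one_smul]
  have hproj : LinearMap.IsProj (LinearMap.range (toLin' P)) (toLin' P) := by
    refine ⟨fun x => ⟨x, rfl⟩, ?_⟩
    rintro _ ⟨x, rfl⟩
    rw [← LinearMap.comp_apply, ← toLin'_mul, hPP]
  refine ⟨LinearMap.range (toLin' P), ?_, ?_⟩
  · have htr := hproj.trace
    rw [trace_toLin'_eq, hP, trace_smul, trace_add, trace_smul, trace_one, Fintype.card_fin,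
      show T.trace = 0 from Finset.sum_eq_zero fun i _ => h0 i] at htr
    have h : ((q : ℝ) ^ 2 + q)⁻¹ • (0 + (q : ℝ) • ((q ^ 3 + 1 : ℕ) : ℝ)) =
        ((q ^ 2 - q + 1 : ℕ) : ℝ) := by
      rw [smul_eq_mul, smul_eq_mul, inv_mul_eq_iff_eq_mul₀ hq'.ne', Nat.cast_add (q ^ 2 - q),
        Nat.cast_sub (Nat.le_self_pow two_ne_zero q)]
      push_cast
      ring
    rw [h] at htr
    exact_mod_cast htr.symm
  · rintro _ ⟨x, rfl⟩
    rw [toLin'_apply, mulVec_mulVec, hTP, smul_mulVec]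

theorem finrank_le_finrank_inf_ker_add_one {E : Type*} [AddCommGroup E] [Module ℝ E]
    [FiniteDimensional ℝ E] (W : Submodule ℝ E) (f : E →ₗ[ℝ] ℝ) :
    finrank ℝ W ≤ finrank ℝ (W ⊓ LinearMap.ker f : Submodule ℝ E) + 1 := by
  have h1 := Submodule.finrank_sup_add_finrank_inf_eq W (LinearMap.ker f)
  have h2 := f.finrank_range_add_finrank_ker
  have h3 : finrank ℝ (LinearMap.range f) ≤ 1 := by
    simpa using (LinearMap.range f).finrank_le
  have h4 := (W ⊔ LinearMap.ker f).finrank_le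
  omega

variable {n : ℕ} {T : Matrix (Fin n) (Fin n) ℝ}

/-- On vectors orthogonal to the ones vector `J` vanishes, so `(J - I - T)/2` acts there with
quotient `-(θ + 1)/2`. -/
theorem exists_graph_graphEigenvalue_le (h0 : ∀ i, T i i = 0)
    (hs : ∀ i j, T i j = T j i) (h1 : ∀ i j, i ≠ j → T i j = 1 ∨ T i j = -1) {θ : ℝ} {d : ℕ}
    (hd : 1 ≤ d) (W : Submodule ℝ (Fin n → ℝ)) (hW : finrank ℝ W = d + 1)
    (hT : ∀ x ∈ W, T *ᵥ x = θ • x) :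
    ∃ G : SimpleGraph (Fin n), graphEigenvalue G (n - d + 1) ≤ -(θ + 1) / 2 := by
  let G : SimpleGraph (Fin n) :=
    { Adj := fun i j => T i j = -1
      symm := ⟨fun i j h => by rw [hs, h]⟩
      loopless := ⟨fun i h => by rw [h0] at h; norm_num at h⟩ }
  have hG : graphMatrix G = (2⁻¹ : ℝ) • (vecMulVec 1 1 - 1 - T) := by
    ext i j
    simp only [graphMatrix, SimpleGraph.adjMatrix_apply, Matrix.smul_apply, Matrix.sub_apply,
      vecMulVec_apply, Pi.one_apply, Matrix.one_apply, smul_eq_mul, G]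
    by_cases hij : i = j
    · subst hij
      simp [h0]
    · rcases h1 i j hij with h | h <;> simp [h, hij] <;> norm_num
  let f : (Fin n → ℝ) →ₗ[ℝ] ℝ := dotProductBilin ℝ ℝ 1
  refine ⟨G, graphEigenvalue_le G (W ⊓ LinearMap.ker f) hd ?_ ?_⟩
  · have := finrank_le_finrank_inf_ker_add_one W f
    omega
  · rintro x ⟨hxW, hxf⟩
    have hx1 : (1 : Fin n → ℝ) ⬝ᵥ x = 0 := hxf
    rw [hG, smul_mulVec, sub_mulVec, sub_mulVec, one_mulVec, hT x hxW, vecMulVec_mulVec, hx1]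
    simp only [dotProduct_smul, dotProduct_sub, smul_eq_mul]
    simp
    linarith

/-- Vectors constant on the blown-up cliques pull back `W` injectively. Pulling back multiplies the
quotient of `(J + I + T)/2` by `t`, and removing the loops subtracts `1`. -/
theorem exists_graph_le_graphEigenvalue (h0 : ∀ i, T i i = 0)
    (hs : ∀ i j, T i j = T j i) (h1 : ∀ i j, i ≠ j → T i j = 1 ∨ T i j = -1) {θ : ℝ} {d : ℕ}
    (hd : 1 ≤ d) (W : Submodule ℝ (Fin n → ℝ)) (hW : finrank ℝ W = d)
    (hT : ∀ x ∈ W, T *ᵥ x = θ • x) {t : ℕ} (ht : 1 ≤ t) :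
    ∃ G : SimpleGraph (Fin (n * t)), t * (θ + 1) / 2 - 1 ≤ graphEigenvalue G d := by
  let π : Fin (n * t) → Fin n := fun u => (finProdFinEquiv.symm u).1
  have hπe (p : Fin n × Fin t) : π (finProdFinEquiv p) = p.1 := by
    simp only [π, Equiv.symm_apply_apply]
  have hsum (f : Fin n → ℝ) : ∑ u, f (π u) = t * ∑ i, f i := by
    rw [← finProdFinEquiv.sum_comp, Fintype.sum_prod_type, Finset.mul_sum]
    simp [hπe]
  have hπ : Function.Surjective π := fun i => ⟨finProdFinEquiv (i, ⟨0, ht⟩), hπe _⟩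
  let G : SimpleGraph (Fin (n * t)) :=
    { Adj := fun u v => u ≠ v ∧ (π u = π v ∨ T (π u) (π v) = 1)
      symm := ⟨fun u v h => ⟨h.1.symm, h.2.imp Eq.symm fun h => by rw [hs, h]⟩⟩
      loopless := ⟨fun u h => h.1 rfl⟩ }
  let B : Matrix (Fin n) (Fin n) ℝ := (2⁻¹ : ℝ) • (vecMulVec 1 1 + 1 + T)
  have hG : graphMatrix G = B.submatrix π π - 1 := by
    ext u v
    simp only [graphMatrix, SimpleGraph.adjMatrix_apply, Matrix.smul_apply, Matrix.sub_apply,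
      submatrix_apply, Matrix.add_apply, vecMulVec_apply, Pi.one_apply, Matrix.one_apply,
      smul_eq_mul, G, B]
    by_cases huv : u = v
    · subst huv
      simp [h0]
      norm_num
    by_cases hp : π u = π v
    · simp [huv, hp, h0]
      norm_num
    · rcases h1 _ _ hp with h | h <;> simp [h, hp, huv] <;> norm_num
  refine ⟨G, le_graphEigenvalue G (W.map (LinearMap.funLeft ℝ ℝ π)) hd ?_ ?_⟩
  · rw [← hW, LinearEquiv.finrank_eq
      (W.equivMapOfInjective _ (LinearMap.funLeft_injective_of_surjective ℝ ℝ _ hπ))]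
  · rintro _ ⟨x, hxW, rfl⟩
    have hBx : B.submatrix π π *ᵥ LinearMap.funLeft ℝ ℝ π x =
        LinearMap.funLeft ℝ ℝ π ((t : ℝ) • (B *ᵥ x)) := by
      ext u
      exact hsum fun j => B (π u) j * x j
    have hxB (y : Fin n → ℝ) : LinearMap.funLeft ℝ ℝ π x ⬝ᵥ LinearMap.funLeft ℝ ℝ π y =
        t * (x ⬝ᵥ y) := hsum fun i => x i * y i
    have hB : (θ + 1) / 2 * (x ⬝ᵥ x) ≤ x ⬝ᵥ B *ᵥ x := by
      simp only [B]
      rw [smul_mulVec, add_mulVec, add_mulVec, one_mulVec, hT x hxW, vecMulVec_mulVec]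
      simp only [dotProduct_smul, dotProduct_add, smul_eq_mul, op_smul_eq_smul]
      rw [dotProduct_comm x 1]
      -- The contribution of `J` is the square of the coordinate sum, so it can be dropped.
      nlinarith [mul_self_nonneg ((1 : Fin n → ℝ) ⬝ᵥ x)]
    rw [hG, sub_mulVec, one_mulVec, dotProduct_sub, hBx, hxB, hxB, dotProduct_smul, smul_eq_mul]
    have := mul_le_mul_of_nonneg_left hB (mul_self_nonneg (t : ℝ))
    linarith

end Seidel

/-! ### The numerical comparison and the conclusion. -/

theorem one_div_two_mul_sqrt_add_one_lt {q : ℝ} (hq : 3 ≤ q) :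
    1 / (2 * Real.sqrt (q ^ 2 - q) + 1) < (4 * (q ^ 2 + 1) - 1) / ((q ^ 3 + 1) * 8) := by
  -- The expansion of the root is `q - 1/2 - 1/(8q) - ⋯`; doubling the third term gives a true lower
  -- bound.
  have h1 : q - 1 / 2 - 1 / (4 * q) ≤ Real.sqrt (q ^ 2 - q) := by
    apply Real.le_sqrt_of_sq_le
    have h3 : 1 / (4 * q) * q = 1 / 4 := by field_simp
    have h4 : 1 / (4 * q) ≤ 1 / 12 := by
      apply one_div_le_one_div_of_le <;> linarith
    have h5 : 0 < 1 / (4 * q) := by positivity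
    nlinarith
  have h2 : 0 < 2 * q - 1 / (2 * q) := by
    have : 1 / (2 * q) ≤ 1 / 6 := by
      apply one_div_le_one_div_of_le <;> linarith
    linarith
  calc _ ≤ 1 / (2 * q - 1 / (2 * q)) := by
        apply one_div_le_one_div_of_le h2
        have : 1 / (2 * q) = 2 * (1 / (4 * q)) := by field_simp; norm_num
        linarith
    _ < _ := by
        -- Cross-multiplied, the claim is `8q³ + 8 < 8q³ + 4q - 3/(2q)`, which holds from `q = 3`
        -- on.
        rw [div_lt_div_iff₀ h2 (by positivity)]
        have h3 : 1 / (2 * q) * q = 1 / 2 := by field_simp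
        have h4 : 1 / (2 * q) ≤ 1 / 6 := by
          apply one_div_le_one_div_of_le <;> linarith
        have h5 : 1 / (2 * q) * q ^ 2 = q / 2 := by field_simp
        nlinarith

theorem mainTheorem9 (q k : ℕ) (hq : IsPrimePow q) (hodd : Odd q) (hk : k = q ^ 2 - q + 1) :
    1 / (2 * Real.sqrt ((k : ℝ) - 1) + 1) < cPos k ∧
    1 / (2 * Real.sqrt ((k : ℝ) - 1) + 1) < cNeg (k - 1) ∧
    1 / (2 * Real.sqrt ((k : ℝ) - 1) + 1) < cNegSigned (k - 1) := by
  have hq3 : 3 ≤ q := by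
    have := hq.one_lt
    obtain ⟨m, rfl⟩ := hodd
    omega
  have hqq : q < q ^ 2 := by nlinarith
  have hq23 : q ^ 2 ≤ q ^ 3 := Nat.pow_le_pow_right (by omega) (by norm_num)
  have hq3' : (3 : ℝ) ≤ q := by exact_mod_cast hq3
  have hk' : (k : ℝ) - 1 = (q : ℝ) ^ 2 - q := by
    rw [hk, Nat.cast_add, Nat.cast_sub hqq.le]
    push_cast
    ring
  have hlt := one_div_two_mul_sqrt_add_one_lt hq3'
  rw [hk']
  obtain ⟨T, h0, hs, h1, hT⟩ := exists_unitary_seidelMatrix_fin hq hodd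
  obtain ⟨W, hW, hWT⟩ := exists_eigenspace_of_mul_self (by omega) h0 hT
  -- Cliques of size `8` reduce the ratio `(q² + 1)/(2(q³ + 1))` by `1/(8(q³ + 1))`, small enough
  -- for the strict inequality already at `q = 3`.
  obtain ⟨G, hG⟩ := exists_graph_le_graphEigenvalue (d := k) h0 hs h1 (by omega) W (by omega) hWT
    (t := 8) (by norm_num)
  obtain ⟨H, hH⟩ := exists_graph_graphEigenvalue_le (d := k - 1) h0 hs h1
    (by omega) W (by omega) hWT
  have hneg : 1 / (2 * Real.sqrt ((q : ℝ) ^ 2 - q) + 1) <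
      -graphEigenvalue H (q ^ 3 + 1 - (k - 1) + 1) / (q ^ 3 + 1 : ℕ) := by
    refine hlt.trans ?_
    push_cast
    rw [div_lt_div_iff₀ (by positivity) (by positivity)]
    have hp : (0 : ℝ) < (q : ℝ) ^ 3 + 1 := by positivity
    nlinarith
  refine ⟨?_, ?_, ?_⟩
  · refine lt_of_lt_of_le hlt (le_trans ?_ (graphEigenvalue_div_le_cPos G (by omega)))
    push_cast at hG ⊢
    apply div_le_div_of_nonneg_right _ (by positivity)
    linarith
  · refine lt_of_lt_of_le hneg (le_trans ?_ (abs_graphEigenvalue_div_le_cNeg H (by omega)))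
    exact div_le_div_of_nonneg_right (neg_le_abs _) (Nat.cast_nonneg _)
  · exact lt_of_lt_of_le hneg (neg_graphEigenvalue_div_le_cNegSigned H (by omega))
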